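/- **Setting.** A market has a finite set $\mathcal I$ of customers and a finite set $\mathcal J$ of providers; $A=\mathcal I\cup\mathcal J$ (disjoint) is the set of agents, and all agents arrive in every round. A matching $X\subseteq\mathcal I\times\mathcal J$ is a set of pairwise disjoint pairs; $\mu_X(a)$ is the partner of $a$ in $X$, and $\mu_X(a)=a$ if $a$ is unmatched. Transfers $\tau\in\mathbb R^A$ are zero-sum for $X$ if $\tau_i+\tau_j=0$ for $(i,j)\in X$ and $\tau_a=0$ for unmatched $a$; a market outcome is a matching $X$ with zero-sum transfers $\tau$. For utilities $u\colon A\times A\to\mathbb R$, write $u_a(a')=u(a,a')$. The Subset Instability of $(X,\tau)$ is $$I(u;X,\tau)=\max_{S\subseteq A}\Bigl[\Bigl(\max_{X'\in\mathscr X_S}\sum_{a\in S}u_a(\mu_{X'}(a))\Bigr)-\sum_{a\in S}\bigl(u_a(\mu_X(a))+\tau_a\bigr)\Bigr],$$ where $\mathscr X_S$ is the set of matchings all of whose pairs consist of members of $S$. An instance with unstructured preferences consists of utilities $u\colon A\times A\to[-1,1]$, with $u(a,a')=0$ whenever $a,a'$ are on the same side (in particular $u(a,a)=0$), and of $1$-subgaussian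 laws of independent noise variables $\varepsilon_{a,t}$ for all agents $a$ and rounds $t$. An algorithm (possibly randomized, and allowed to depend on $\mathcal I$, $\mathcal J$ and on the number of rounds $T$) selects in each round $t$ a market outcome $(X^t,\tau^t)$ on the basis of its previously selected outcomes and previous observations, and then observes $u_a(\mu_{X^t}(a))+\varepsilon_{a,t}$ for every $a\in A$. The noise of round $t$ is independent of the past and of $(X^t,\tau^t)$. The regret is $R_T=\sum_{t=1}^T I(u;X^t,\tau^t)$. **Lemma.** There are an absolute constant $c>0$ and an absolute exponent $p\in\mathbb N$ such that the following holds for all integers $n\ge 2$ and $T\ge n$. There are sets $\mathcal I$, $\mathcal J$ of customers and providers with $|A|=|\mathcal I|+|\mathcal J|=n$ such that for every algorithm there is an instance with unstructured preferences on which its expected regret satisfies $$\mathbb E[R_T]\;\ge\; c\,\frac{|A|^{3/2}\sqrt T}{\bigl(\log(|A|\,T)\bigr)^{p}} .$$ That is, every algorithm has an instance with expected Subset Instability regret $\widetilde\Omega(|A|^{3/2}\sqrt T)$. -/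

import Mathlib

open MeasureTheory ProbabilityTheory

noncomputable section

namespace MatchingBandit

/-- A matching between the customers `I` and the providers `J`: a set of pairs that are pairwise
disjoint. -/
abbrev Matching (I J : Type) : Type :=
  {X : Finset (I × J) // ∀ p ∈ X, ∀ q ∈ X, p ≠ q → p.1 ≠ q.1 ∧ p.2 ≠ q.2}

/-- There are finitely many matchings in a finite market; every set of matchings is measurable. -/
instance (I J : Type) : MeasurableSpace (Matching I J) := ⊤

open Classical in
/-- The functional representation `μ_X` of a matching `X` on the set of agents `I ⊕ J`: a matched
agent is sent to its partner, an unmatched agent to itself. -/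
def partner {I J : Type} (X : Matching I J) : I ⊕ J → I ⊕ J
  | Sum.inl i => if h : ∃ j, (i, j) ∈ X.1 then Sum.inr h.choose else Sum.inl i
  | Sum.inr j => if h : ∃ i, (i, j) ∈ X.1 then Sum.inl h.choose else Sum.inr j

theorem partner_inl_eq_inr_iff {I J : Type} (X : Matching I J) (i : I) (j : J) :
    partner X (Sum.inl i) = Sum.inr j ↔ (i, j) ∈ X.1 := by
  unfold partner
  by_cases h : ∃ j, (i, j) ∈ X.1
  · simp only [h, dite_true, Sum.inr.injEq]
    constructor
    · rintro rfl
      exact h.choose_spec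
    · intro hj
      by_contra hne
      exact (X.2 _ h.choose_spec _ hj (by simpa using hne)).1 rfl
  · simp only [h, dite_false, reduceCtorEq, false_iff]
    exact fun hj => h ⟨j, hj⟩

theorem partner_inr_eq_inl_iff {I J : Type} (X : Matching I J) (i : I) (j : J) :
    partner X (Sum.inr j) = Sum.inl i ↔ (i, j) ∈ X.1 := by
  unfold partner
  by_cases h : ∃ i, (i, j) ∈ X.1
  · simp only [h, dite_true, Sum.inl.injEq]
    constructor
    · rintro rfl
      exact h.choose_spec
    · intro hi
      by_contra hne
      exact (X.2 _ h.choose_spec _ hi (by simpa using hne)).2 rfl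
  · simp only [h, dite_false, reduceCtorEq, false_iff]
    exact fun hi => h ⟨i, hi⟩

/-- `X` is a matching over the coalition `S`: it only uses pairs of members of `S`. -/
def IsMatchingOn {I J : Type} (S : Finset (I ⊕ J)) (X : Matching I J) : Prop :=
  ∀ p ∈ X.1, Sum.inl p.1 ∈ S ∧ Sum.inr p.2 ∈ S

/-- Transfers are zero-sum for a matching if they cancel on every matched pair and vanish on every
unmatched agent. -/
def IsZeroSum {I J : Type} (X : Matching I J) (τ : I ⊕ J → ℝ) : Prop :=
  (∀ p ∈ X.1, τ (Sum.inl p.1) + τ (Sum.inr p.2) = 0) ∧ ∀ a, partner X a = a → τ a = 0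

/-- A market outcome: a matching together with zero-sum transfers (with the subspace sigma-algebra
of the product). -/
abbrev MarketOutcome (I J : Type) : Type :=
  {o : Matching I J × (I ⊕ J → ℝ) // IsZeroSum o.1 o.2}

section Instability

variable {I J : Type} [Fintype I] [Fintype J]

/-- The maximum total utility `max_{X' ∈ 𝒳_S} ∑_{a ∈ S} u_a(μ_{X'}(a))` of a matching over the
coalition `S`. The maximum ranges over a finite set that contains the empty matching. -/
def maxCoalitionUtility (u : I ⊕ J → I ⊕ J → ℝ) (S : Finset (I ⊕ J)) : ℝ :=
  ⨆ X' : {X' : Matching I J // IsMatchingOn S X'}, ∑ a ∈ S, u a (partner X'.1 a)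

/-- Subset Instability of the matching with transfers `(X, τ)`: the maximum over all coalitions
`S` of the maximum total utility of a matching over `S`, minus the total net utility of `S`
under `(X, τ)`. The maximum ranges over a finite nonempty set. -/
def subsetInstability (u : I ⊕ J → I ⊕ J → ℝ) (X : Matching I J) (τ : I ⊕ J → ℝ) : ℝ :=
  ⨆ S : Finset (I ⊕ J), (maxCoalitionUtility u S - ∑ a ∈ S, (u a (partner X a) + τ a))

end Instability

/-- What the platform sees in one round: the selected market outcome and one noisy utility for
each agent. -/
abbrev RoundData (I J : Type) : Type := MarketOutcome I J × (I ⊕ J → ℝ)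

/-- What the platform has seen in the first `t` rounds. -/
abbrev History (I J : Type) (t : ℕ) : Type := Fin t → RoundData I J

/-- A (possibly randomized) learning algorithm for the market with customers `I` and providers `J`:
in each round, counted from `0`, the market outcome is drawn from a law that depends measurably on
the history. -/
structure Algorithm (I J : Type) where
  policy : (t : ℕ) → Kernel (History I J t) (MarketOutcome I J)
  isMarkov : ∀ t, IsMarkovKernel (policy t)

/-- An instance with unstructured preferences: utilities with values in `[-1, 1]`, zero between
agents on the same side and for an unmatched agent, and for each agent `a` and round `t` a noise law
that is `1`-subgaussian (`𝔼 exp(s ε) ≤ exp(s² / 2)` for all real `s`). -/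
structure UnstructuredInstance (I J : Type) where
  utility : I ⊕ J → I ⊕ J → ℝ
  utility_mem : ∀ a a', utility a a' ∈ Set.Icc (-1 : ℝ) 1
  utility_inl_inl : ∀ i i', utility (Sum.inl i) (Sum.inl i') = 0
  utility_inr_inr : ∀ j j', utility (Sum.inr j) (Sum.inr j') = 0
  noise : I ⊕ J → ℕ → Measure ℝ
  noise_isProbability : ∀ a t, IsProbabilityMeasure (noise a t)
  noise_subgaussian : ∀ a t, HasSubgaussianMGF (fun x : ℝ => x) 1 (noise a t)

section Interaction

variable {I J : Type} [Fintype I] [Fintype J]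

/-- One round appended to the history: if `o` is selected and the noise is `ε`, then the utility
`u_a(μ_X(a)) + ε_a` is observed for every agent `a`. -/
def extendHistory (u : I ⊕ J → I ⊕ J → ℝ) (t : ℕ)
    (x : (History I J t × MarketOutcome I J) × (I ⊕ J → ℝ)) : History I J (t + 1) :=
  Fin.snoc (α := fun _ => RoundData I J) x.1.1
    (x.1.2, fun a => u a (partner x.1.2.1.1 a) + x.2 a)

/-- The law of the history of the first `t` rounds when all agents arrive in each round. In each
round the outcome is drawn from the policy given the past, and the noise variables of the round are
independent of each other, of the past and of the outcome. -/
def historyLaw (alg : Algorithm I J) (inst : UnstructuredInstance I J) :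
    (t : ℕ) → Measure (History I J t)
  | 0 => Measure.dirac Fin.elim0
  | t + 1 =>
      (((historyLaw alg inst t) ⊗ₘ (alg.policy t)).prod
        (Measure.pi fun a => inst.noise a t)).map (extendHistory inst.utility t)

/-- The cumulative Subset Instability of the selected market outcomes. -/
def regret (u : I ⊕ J → I ⊕ J → ℝ) {T : ℕ} (h : History I J T) : ℝ :=
  ∑ t : Fin T, subsetInstability u (h t).1.1.1 (h t).1.1.2

/-- The expected regret after `T` rounds. The regret is nonnegative but may be unbounded, so its
expectation lies in `[0, ∞]`. -/
def expectedRegret (alg : Algorithm I J) (inst : UnstructuredInstance I J) (T : ℕ) : ENNReal :=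
  ∫⁻ h, ENNReal.ofReal (regret inst.utility h) ∂(historyLaw alg inst T)

end Interaction

end MatchingBandit

end

open MeasureTheory ProbabilityTheory

noncomputable section

namespace MatchingBandit

/-! ### Shifting one coordinate of a standard Gaussian vector -/

/-! Take `k` customers, `l ≥ 2 * k` providers and standard Gaussian noise. Customer `i` has a hidden
favourite `σ i`, worth `Δ` of order `√(l / T)`; all other utilities vanish. For the coalition of all
agents the transfers cancel, so Subset Instability is at least the welfare gap to any matching
(`welfare_sub_le_subsetInstability`). A matching can serve every distinct favourite, on average over
`σ` at least `2 / 3 * k` of them. Finding a favourite is a bandit problem with `l` arms. Compared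
with the instance where `i` has no favourite, each match of `i` with `σ i` gives information `Δ ^ 2
/ 2`, and the `T` rounds are shared among `l` candidates. By change of measure
(`expectedPairCount_change_pair_le`) and averaging over `σ`, each customer meets the favourite in at
most `7 / 12` of the rounds. The loss is of order `T * k * Δ`, that is `k * √(l * T)`, without
logarithms. With `k` and `l` proportional to `n` this is the claim; `n = 2` is a two-point test. -/

theorem lintegral_gaussianReal_add_const (d : ℝ) {g : ℝ → ENNReal} (hg : Measurable g) :
    ∫⁻ x, g (x + d) ∂gaussianReal 0 1 =
      ∫⁻ x, g x * ENNReal.ofReal (Real.exp (d * x - d ^ 2 / 2)) ∂gaussianReal 0 1 := by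
  have h1 : ∫⁻ x, g (x + d) ∂gaussianReal 0 1 = ∫⁻ x, g x ∂gaussianReal d 1 := by
    have := gaussianReal_map_add_const (μ := 0) (v := 1) d
    rw [zero_add] at this
    rw [← this, lintegral_map hg (by fun_prop)]
  rw [h1, gaussianReal_of_var_ne_zero d one_ne_zero, gaussianReal_of_var_ne_zero 0 one_ne_zero,
    lintegral_withDensity_eq_lintegral_mul _ (measurable_gaussianPDF _ _) hg,
    lintegral_withDensity_eq_lintegral_mul _ (measurable_gaussianPDF _ _) (by fun_prop)]
  refine lintegral_congr fun x => ?_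
  have h2 : gaussianPDF d 1 x =
      gaussianPDF 0 1 x * ENNReal.ofReal (Real.exp (d * x - d ^ 2 / 2)) := by
    rw [gaussianPDF, gaussianPDF, ← ENNReal.ofReal_mul (gaussianPDFReal_nonneg _ _ _),
      gaussianPDFReal, gaussianPDFReal, mul_assoc (√_)⁻¹, ← Real.exp_add]
    congr 3
    push_cast
    ring
  simp only [Pi.mul_apply, h2]
  ring

theorem lintegral_pi_gaussianReal_add_single {ι : Type*} [Fintype ι] [DecidableEq ι]
    (i : ι) (d : ℝ) {G : (ι → ℝ) → ENNReal} (hG : Measurable G) :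
    ∫⁻ x, G (x + Pi.single i d) ∂Measure.pi (fun _ : ι => gaussianReal 0 1) =
      ∫⁻ x, G x * ENNReal.ofReal (Real.exp (d * x i - d ^ 2 / 2))
        ∂Measure.pi (fun _ : ι => gaussianReal 0 1) := by
  refine lintegral_eq_of_lmarginal_eq {i} (by fun_prop) (by fun_prop) ?_
  ext x
  rw [lmarginal_singleton, lmarginal_singleton]
  have h := lintegral_gaussianReal_add_const d (g := fun y => G (Function.update x i y))
    (hG.comp (measurable_update x))
  simp only [Function.update_self]
  rw [← h]
  refine lintegral_congr fun y => ?_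
  congr 1
  ext j
  by_cases hj : j = i
  · subst hj; simp
  · simp [hj]

/-- The factor `exp (d * x - d ^ 2 / 2)` has mean one and its exponent has mean `-d ^ 2 / 2`. This
is the growth of relative entropy in one round; the nonnegative form `exp z - 1 - z` suits `ENNReal`
integrals. -/
theorem lintegral_pi_gaussianReal_exp_sub_one_sub {ι : Type*} [Fintype ι]
    (i : ι) (d g : ℝ) :
    ∫⁻ x, ENNReal.ofReal (Real.exp (g + (d * x i - d ^ 2 / 2)) - 1 - (g + (d * x i - d ^ 2 / 2)))
        ∂Measure.pi (fun _ : ι => gaussianReal 0 1) =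
      ENNReal.ofReal (Real.exp g - 1 - g) + ENNReal.ofReal (d ^ 2 / 2) := by
  have hmp := measurePreserving_eval (fun _ : ι => gaussianReal 0 1) i
  rw [hmp.lintegral_comp (f := fun y : ℝ => ENNReal.ofReal
    (Real.exp (g + (d * y - d ^ 2 / 2)) - 1 - (g + (d * y - d ^ 2 / 2)))) (by fun_prop)]
  have hexp : ∀ y : ℝ, Real.exp (g + (d * y - d ^ 2 / 2)) =
      Real.exp (g - d ^ 2 / 2) * Real.exp (d * y) := fun y => by
    rw [← Real.exp_add]; ring_nf
  have hi1 : Integrable (fun y : ℝ => Real.exp (g - d ^ 2 / 2) * Real.exp (d * y))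
      (gaussianReal 0 1) := (integrable_exp_mul_gaussianReal d).const_mul _
  have hid : Integrable (fun y : ℝ => y) (gaussianReal 0 1) :=
    (memLp_id_gaussianReal 1).integrable le_rfl
  have hlin : Integrable (fun y : ℝ => d * y - d ^ 2 / 2) (gaussianReal 0 1) :=
    (hid.const_mul d).sub (integrable_const _)
  have hi2 : Integrable (fun y : ℝ => g + (d * y - d ^ 2 / 2)) (gaussianReal 0 1) :=
    (integrable_const g).add hlin
  have hmgf : ∫ y, Real.exp (d * y) ∂gaussianReal 0 1 = Real.exp (d ^ 2 / 2) := by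
    have := congrFun (mgf_fun_id_gaussianReal (μ := 0) (v := 1)) d
    simpa [mgf] using this
  have hnn : ∀ z : ℝ, 0 ≤ Real.exp z - 1 - z := fun z => by
    linarith [Real.add_one_le_exp z]
  rw [← ENNReal.ofReal_add (hnn g) (by positivity), ← ofReal_integral_eq_lintegral_ofReal]
  · congr 1
    simp_rw [hexp]
    rw [integral_sub (f := fun y : ℝ => Real.exp (g - d ^ 2 / 2) * Real.exp (d * y) - 1)
        (hi1.sub (integrable_const _)) hi2, integral_sub hi1 (integrable_const _),
      integral_add (integrable_const g) hlin,
      integral_sub (hid.const_mul d) (integrable_const _), integral_const_mul,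
      integral_const_mul, hmgf, integral_id_gaussianReal, ← Real.exp_add]
    simp
    ring
  · simp_rw [hexp]
    exact (hi1.sub (integrable_const _)).sub hi2
  · exact Filter.Eventually.of_forall fun y => hnn _

/-- A pointwise substitute for Pinsker's inequality. With `y = exp (g / 2)`, the entropy term
dominates the Hellinger term `(y - 1) ^ 2`, and `y ^ 2 - 1 ≤ 2 * y * (y - 1) + (y - 1) ^ 2` is
handled by completing a square with weight `r`. -/
theorem exp_le_of_pos (g : ℝ) {r : ℝ} (hr : 0 < r) :
    Real.exp g ≤ 1 + r * Real.exp g + (Real.exp g - 1 - g) / r := by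
  set y := Real.exp (g / 2) with hy
  have hypos : 0 < y := Real.exp_pos _
  have hyy : Real.exp g = y ^ 2 := by rw [hy, ← Real.exp_nat_mul]; ring_nf
  have hg : g ≤ 2 * (y - 1) := by linarith [Real.add_one_le_exp (g / 2)]
  rw [hyy]
  have h1 : (y - 1) ^ 2 / r ≤ (y ^ 2 - 1 - g) / r := by gcongr; nlinarith
  have h2 : y ^ 2 - 1 ≤ r * y ^ 2 + (y - 1) ^ 2 / r := by
    have h3 : 0 ≤ (r * y - (y - 1)) ^ 2 / r := by positivity
    have h4 : (r * y - (y - 1)) ^ 2 / r = r * y ^ 2 - 2 * y * (y - 1) + (y - 1) ^ 2 / r := by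
      field_simp
      ring
    nlinarith [sq_nonneg (y - 1)]
  linarith

/-! ### Instances with Gaussian noise, in which only the customers' utilities matter -/

section Pair

variable {I J : Type}

def pairUtility (w : I → J → ℝ) : I ⊕ J → I ⊕ J → ℝ
  | Sum.inl i, Sum.inr j => w i j
  | _, _ => 0

def gaussianInstance (w : I → J → ℝ) (hw : ∀ i j, w i j ∈ Set.Icc (-1 : ℝ) 1) :
    UnstructuredInstance I J where
  utility := pairUtility w
  utility_mem a a' := by
    rcases a with i | j <;> rcases a' with i' | j' <;> simp only [pairUtility]
    all_goals first | exact hw _ _ | simp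
  utility_inl_inl _ _ := rfl
  utility_inr_inr _ _ := rfl
  noise _ _ := gaussianReal 0 1
  noise_isProbability _ _ := inferInstance
  noise_subgaussian _ _ :=
    ⟨fun s => integrable_exp_mul_gaussianReal s, fun s => by simp [mgf_fun_id_gaussianReal]⟩

theorem pairUtility_apply_inr (w : I → J → ℝ) (j : J) (a : I ⊕ J) :
    pairUtility w (Sum.inr j) a = 0 := by
  cases a <;> rfl

theorem pairUtility_inl_partner_of_mem (w : I → J → ℝ) {X : Matching I J} {i : I} {j : J}
    (h : (i, j) ∈ X.1) : pairUtility w (Sum.inl i) (partner X (Sum.inl i)) = w i j := by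
  rw [(partner_inl_eq_inr_iff X i j).2 h]
  rfl

theorem measurable_extendHistory (u : I ⊕ J → I ⊕ J → ℝ) (t : ℕ) :
    Measurable (extendHistory u t) := by
  refine measurable_pi_lambda _ fun s => ?_
  induction s using Fin.lastCases with
  | last =>
    simp only [extendHistory, Fin.snoc_last]
    refine Measurable.prodMk (by fun_prop) (measurable_pi_lambda _ fun a => ?_)
    refine Measurable.add ?_ (by fun_prop)
    exact (measurable_from_top (f := fun X : Matching I J => u a (partner X a))).comp
      (by fun_prop)
  | cast s =>
    simp only [extendHistory, Fin.snoc_castSucc]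
    fun_prop

end Pair

/-! ### Integration over one round of the history -/

section Law

variable {I J : Type} [Fintype I] [Fintype J]

instance isProbabilityMeasure_historyLaw (alg : Algorithm I J) (inst : UnstructuredInstance I J)
    (t : ℕ) : IsProbabilityMeasure (historyLaw alg inst t) := by
  induction t with
  | zero => rw [historyLaw]; infer_instance
  | succ t ih =>
    have := alg.isMarkov t
    have := fun a => inst.noise_isProbability a t
    rw [historyLaw]
    exact Measure.isProbabilityMeasure_map (measurable_extendHistory _ _).aemeasurable

theorem lintegral_historyLaw_succ (alg : Algorithm I J) (inst : UnstructuredInstance I J) (t : ℕ)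
    {F : History I J (t + 1) → ENNReal} (hF : Measurable F) :
    ∫⁻ h, F h ∂historyLaw alg inst (t + 1) =
      ∫⁻ h, ∫⁻ o, ∫⁻ x, F (extendHistory inst.utility t ((h, o), x))
        ∂Measure.pi (fun a => inst.noise a t) ∂alg.policy t h ∂historyLaw alg inst t := by
  have := alg.isMarkov t
  have := fun a => inst.noise_isProbability a t
  have hm := hF.comp (measurable_extendHistory inst.utility t)
  rw [historyLaw, lintegral_map hF (measurable_extendHistory _ _), lintegral_prod (fun z => F (extendHistory inst.utility t z)) hm.aemeasurable,
    Measure.lintegral_compProd (Measurable.lintegral_prod_right'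
      (f := fun z => F (extendHistory inst.utility t z)) hm)]

end Law

/-! ### Changing the utility of a customer for a single provider -/

section ChangeOfMeasure

variable {I J : Type}

open Classical in
def pairIndicator (i : I) (j : J) (X : Matching I J) : ℝ := if (i, j) ∈ X.1 then 1 else 0

def pairCount (i : I) (j : J) {t : ℕ} (h : History I J t) : ℝ :=
  ∑ s, pairIndicator i j (h s).1.1.1

/-- The log-likelihood ratio of the observed history when the utility `m` of customer `i` for
provider `j` is raised by `d`. -/
def pairLogLikelihood (i : I) (j : J) (m d : ℝ) {t : ℕ} (h : History I J t) : ℝ :=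
  ∑ s, pairIndicator i j (h s).1.1.1 * (d * ((h s).2 (Sum.inl i) - m) - d ^ 2 / 2)

theorem pairIndicator_nonneg (i : I) (j : J) (X : Matching I J) : 0 ≤ pairIndicator i j X := by
  unfold pairIndicator; split_ifs <;> simp

theorem pairIndicator_le_one (i : I) (j : J) (X : Matching I J) : pairIndicator i j X ≤ 1 := by
  unfold pairIndicator; split_ifs <;> simp

theorem pairCount_nonneg (i : I) (j : J) {t : ℕ} (h : History I J t) : 0 ≤ pairCount i j h :=
  Finset.sum_nonneg fun _ _ => pairIndicator_nonneg _ _ _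

theorem pairCount_le (i : I) (j : J) {t : ℕ} (h : History I J t) : pairCount i j h ≤ t :=
  (Finset.sum_le_sum fun _ _ => pairIndicator_le_one _ _ _).trans (by simp)

theorem measurable_pairIndicator (i : I) (j : J) :
    Measurable fun o : MarketOutcome I J => pairIndicator i j o.1.1 :=
  (measurable_from_top (f := pairIndicator i j)).comp (by fun_prop)

theorem measurable_pairIndicator_history (i : I) (j : J) {t : ℕ} (s : Fin t) :
    Measurable fun h : History I J t => pairIndicator i j (h s).1.1.1 :=
  (measurable_pairIndicator i j).comp
    (f := fun h : History I J t => (h s).1) (by fun_prop)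

@[fun_prop]
theorem measurable_pairCount (i : I) (j : J) (t : ℕ) :
    Measurable (pairCount i j : History I J t → ℝ) :=
  Finset.measurable_fun_sum _ fun _ _ => measurable_pairIndicator_history _ _ _

@[fun_prop]
theorem measurable_pairLogLikelihood (i : I) (j : J) (m d : ℝ) (t : ℕ) :
    Measurable (pairLogLikelihood i j m d : History I J t → ℝ) :=
  Finset.measurable_fun_sum _ fun s _ =>
    (measurable_pairIndicator_history i j s).mul (by fun_prop)

theorem pairCount_extendHistory (i : I) (j : J) (u : I ⊕ J → I ⊕ J → ℝ) {t : ℕ}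
    (h : History I J t) (o : MarketOutcome I J) (x : I ⊕ J → ℝ) :
    pairCount i j (extendHistory u t ((h, o), x)) =
      pairCount i j h + pairIndicator i j o.1.1 := by
  simp [pairCount, extendHistory, Fin.sum_univ_castSucc]

/-- When the pair is matched, the observation minus its mean is exactly the noise. The squared
indicator equals the indicator, so both cases are one Gaussian shift of size `pairIndicator * d`. -/
theorem pairLogLikelihood_extendHistory (w : I → J → ℝ) (i : I) (j : J) (d : ℝ) {t : ℕ}
    (h : History I J t) (o : MarketOutcome I J) (x : I ⊕ J → ℝ) :
    pairLogLikelihood i j (w i j) d (extendHistory (pairUtility w) t ((h, o), x)) =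
      pairLogLikelihood i j (w i j) d h +
        ((pairIndicator i j o.1.1 * d) * x (Sum.inl i) -
          (pairIndicator i j o.1.1 * d) ^ 2 / 2) := by
  simp only [pairLogLikelihood, extendHistory, Fin.sum_univ_castSucc, Fin.snoc_castSucc,
    Fin.snoc_last]
  congr 1
  by_cases hm : (i, j) ∈ o.1.1.1
  · rw [pairUtility_inl_partner_of_mem w hm]
    simp [pairIndicator, hm]
  · simp [pairIndicator, hm]

open Classical in
-- The changed entry is visible only when the pair is matched, and then it cannot be told apart from
-- a shift of the noise of customer `i`.
theorem extendHistory_pairUtility_add {w w' : I → J → ℝ} {i : I} {j : J} {d : ℝ}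
    (hij : w' i j = w i j + d) (hne : ∀ i' j', (i', j') ≠ (i, j) → w' i' j' = w i' j') {t : ℕ}
    (h : History I J t) (o : MarketOutcome I J) (x : I ⊕ J → ℝ) :
    extendHistory (pairUtility w') t ((h, o), x) =
      extendHistory (pairUtility w) t
        ((h, o), x + Pi.single (Sum.inl i) (pairIndicator i j o.1.1 * d)) := by
  unfold extendHistory
  congr 2
  funext a
  simp only [Pi.add_apply]
  rcases a with i' | j'
  · by_cases hi : i' = i
    · subst hi
      by_cases hm : (i', j) ∈ o.1.1.1
      · rw [pairUtility_inl_partner_of_mem w hm, pairUtility_inl_partner_of_mem w' hm, hij]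
        simp [pairIndicator, hm]
        ring
      · have : pairUtility w' (Sum.inl i') (partner o.1.1 (Sum.inl i')) =
            pairUtility w (Sum.inl i') (partner o.1.1 (Sum.inl i')) := by
          rcases hp : partner o.1.1 (Sum.inl i') with i'' | j''
          · rfl
          · rw [partner_inl_eq_inr_iff] at hp
            exact hne _ _ fun heq => hm (heq ▸ hp)
        simp [pairIndicator, hm, this]
    · have : pairUtility w' (Sum.inl i') (partner o.1.1 (Sum.inl i')) =
          pairUtility w (Sum.inl i') (partner o.1.1 (Sum.inl i')) := by
        rcases partner o.1.1 (Sum.inl i') with i'' | j''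
        · rfl
        · exact hne _ _ (by simp [hi])
      simp [this, hi]
  · simp [pairUtility_apply_inr]

theorem sum_pairCount_le [Fintype J] (i : I) {t : ℕ} (h : History I J t) :
    ∑ j, pairCount i j h ≤ t := by
  classical
  unfold pairCount
  rw [Finset.sum_comm]
  refine (Finset.sum_le_sum (g := fun _ => (1 : ℝ)) fun s _ => ?_).trans (by simp)
  by_cases hex : ∃ j, (i, j) ∈ (h s).1.1.1.1
  · obtain ⟨j, hj⟩ := hex
    rw [Finset.sum_eq_single j]
    · exact pairIndicator_le_one _ _ _
    · intro j' _ hne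
      unfold pairIndicator
      rw [if_neg]
      intro hj'
      exact ((h s).1.1.1.2 _ hj _ hj' (by simpa using hne.symm)).1 rfl
    · simp
  · push Not at hex
    simp [pairIndicator, hex]

variable [Fintype I] [Fintype J]

/-- The policy kernels are the same in both instances, so only the noise shift of each round
contributes to the likelihood ratio. -/
theorem lintegral_historyLaw_change_pair (alg : Algorithm I J) {w w' : I → J → ℝ}
    (hw : ∀ i j, w i j ∈ Set.Icc (-1 : ℝ) 1) (hw' : ∀ i j, w' i j ∈ Set.Icc (-1 : ℝ) 1)
    {i : I} {j : J} {d : ℝ}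
    (hij : w' i j = w i j + d) (hne : ∀ i' j', (i', j') ≠ (i, j) → w' i' j' = w i' j') (t : ℕ)
    {F : History I J t → ENNReal} (hF : Measurable F) :
    ∫⁻ h, F h ∂historyLaw alg (gaussianInstance w' hw') t =
      ∫⁻ h, F h * ENNReal.ofReal (Real.exp (pairLogLikelihood i j (w i j) d h))
        ∂historyLaw alg (gaussianInstance w hw) t := by
  classical
  induction t with
  | zero =>
    simp only [historyLaw]
    refine lintegral_congr fun h => ?_
    simp [pairLogLikelihood]
  | succ t ih =>
    have := alg.isMarkov t
    rw [lintegral_historyLaw_succ _ _ _ hF, lintegral_historyLaw_succ _ _ _ (by fun_prop)]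
    have hm := hF.comp (measurable_extendHistory (pairUtility w') t)
    refine (ih (F := fun h => ∫⁻ o, ∫⁻ x, F (extendHistory (pairUtility w') t ((h, o), x))
        ∂Measure.pi (fun _ => gaussianReal 0 1) ∂alg.policy t h)
        (Measurable.lintegral_kernel_prod_right' (κ := alg.policy t)
          (f := fun z : History I J t × MarketOutcome I J =>
            ∫⁻ x, F (extendHistory (pairUtility w') t (z, x))
              ∂Measure.pi (fun _ => gaussianReal 0 1))
          (Measurable.lintegral_prod_right'
            (f := fun z => F (extendHistory (pairUtility w') t z)) hm))).trans ?_
    refine lintegral_congr fun h => ?_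
    rw [← lintegral_mul_const' _ _ ENNReal.ofReal_ne_top]
    refine lintegral_congr fun o => ?_
    have hm1 : Measurable fun x => F (extendHistory (pairUtility w) t ((h, o), x)) :=
      hF.comp ((measurable_extendHistory (pairUtility w) t).comp (by fun_prop))
    simp only [gaussianInstance]
    simp_rw [extendHistory_pairUtility_add hij hne, pairLogLikelihood_extendHistory, Real.exp_add,
      ENNReal.ofReal_mul (Real.exp_pos _).le]
    rw [lintegral_pi_gaussianReal_add_single (Sum.inl i) (pairIndicator i j o.1.1 * d) hm1,
      ← lintegral_mul_const' _ _ ENNReal.ofReal_ne_top]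
    refine lintegral_congr fun x => ?_
    ring

/-- Divergence decomposition: every round that matches the pair adds `d ^ 2 / 2` to the relative
entropy, every other round adds nothing. -/
theorem lintegral_exp_sub_one_sub_pairLogLikelihood (alg : Algorithm I J) {w : I → J → ℝ}
    (hw : ∀ i j, w i j ∈ Set.Icc (-1 : ℝ) 1) (i : I) (j : J) (d : ℝ) (t : ℕ) :
    ∫⁻ h, ENNReal.ofReal (Real.exp (pairLogLikelihood i j (w i j) d h) - 1 -
        pairLogLikelihood i j (w i j) d h) ∂historyLaw alg (gaussianInstance w hw) t =
      ENNReal.ofReal (d ^ 2 / 2) * ∫⁻ h, ENNReal.ofReal (pairCount i j h)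
        ∂historyLaw alg (gaussianInstance w hw) t := by
  induction t with
  | zero =>
    simp [pairLogLikelihood, pairCount]
  | succ t ih =>
    have := alg.isMarkov t
    rw [lintegral_historyLaw_succ _ _ _ (by fun_prop), lintegral_historyLaw_succ _ _ _ (by fun_prop)]
    simp only [gaussianInstance]
    simp_rw [pairLogLikelihood_extendHistory, lintegral_pi_gaussianReal_exp_sub_one_sub,
      pairCount_extendHistory,
      ENNReal.ofReal_add (pairCount_nonneg _ _ _) (pairIndicator_nonneg _ _ _)]
    simp only [lintegral_const, measure_univ, mul_one]
    simp_rw [lintegral_add_left measurable_const]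
    simp only [lintegral_const, measure_univ, mul_one]
    change ∫⁻ _, _ ∂historyLaw alg (gaussianInstance w hw) t =
      _ * ∫⁻ _, _ ∂historyLaw alg (gaussianInstance w hw) t
    rw [lintegral_add_left (by fun_prop), lintegral_add_left (by fun_prop), ih, mul_add,
      ← lintegral_const_mul' _ _ ENNReal.ofReal_ne_top]
    congr 1
    rw [← lintegral_const_mul' _ _ ENNReal.ofReal_ne_top]
    refine lintegral_congr fun h => ?_
    rw [← lintegral_const_mul' _ _ ENNReal.ofReal_ne_top]
    refine lintegral_congr fun o => ?_
    rw [← ENNReal.ofReal_mul (by positivity)]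
    congr 1
    unfold pairIndicator
    split_ifs <;> simp

def expectedPairCount (alg : Algorithm I J) (inst : UnstructuredInstance I J) (t : ℕ)
    (i : I) (j : J) : ℝ :=
  ∫ h, pairCount i j h ∂historyLaw alg inst t

theorem integrable_pairCount (alg : Algorithm I J) (inst : UnstructuredInstance I J) (t : ℕ)
    (i : I) (j : J) : Integrable (pairCount i j) (historyLaw alg inst t) :=
  Integrable.of_bound (measurable_pairCount i j t).aestronglyMeasurable (t : ℝ)
    (Filter.Eventually.of_forall fun h => by
      rw [Real.norm_of_nonneg (pairCount_nonneg _ _ _)]; exact pairCount_le _ _ _)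

theorem expectedPairCount_nonneg (alg : Algorithm I J) (inst : UnstructuredInstance I J) (t : ℕ)
    (i : I) (j : J) : 0 ≤ expectedPairCount alg inst t i j :=
  integral_nonneg fun _ => pairCount_nonneg _ _ _

theorem ofReal_expectedPairCount (alg : Algorithm I J) (inst : UnstructuredInstance I J) (t : ℕ)
    (i : I) (j : J) :
    ENNReal.ofReal (expectedPairCount alg inst t i j) =
      ∫⁻ h, ENNReal.ofReal (pairCount i j h) ∂historyLaw alg inst t :=
  ofReal_integral_eq_lintegral_ofReal (integrable_pairCount alg inst t i j)
    (Filter.Eventually.of_forall fun _ => pairCount_nonneg _ _ _)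

theorem sum_expectedPairCount_le (alg : Algorithm I J) (inst : UnstructuredInstance I J) (t : ℕ)
    (i : I) : ∑ j, expectedPairCount alg inst t i j ≤ t := by
  unfold expectedPairCount
  rw [← integral_finsetSum _ fun j _ => integrable_pairCount alg inst t i j]
  refine (integral_mono (integrable_finsetSum _ fun j _ => integrable_pairCount alg inst t i j)
    (integrable_const (t : ℝ)) fun h => sum_pairCount_le i h).trans (by simp)

/-- Apply `exp_le_of_pos` to the log-likelihood ratio, weighted by a count of at most `t`: the ratio
has mean one, and the entropy term is proportional to the expected count itself. The parameter `r`
is free. -/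
theorem expectedPairCount_change_pair_le (alg : Algorithm I J) {w w' : I → J → ℝ}
    (hw : ∀ i j, w i j ∈ Set.Icc (-1 : ℝ) 1) (hw' : ∀ i j, w' i j ∈ Set.Icc (-1 : ℝ) 1)
    {i : I} {j : J} {d : ℝ}
    (hij : w' i j = w i j + d) (hne : ∀ i' j', (i', j') ≠ (i, j) → w' i' j' = w i' j') (t : ℕ)
    {r : ℝ} (hr : 0 < r) :
    expectedPairCount alg (gaussianInstance w' hw') t i j ≤
      expectedPairCount alg (gaussianInstance w hw) t i j +
        t * (r + d ^ 2 / 2 * expectedPairCount alg (gaussianInstance w hw) t i j / r) := by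
  set P := historyLaw alg (gaussianInstance w hw) t with hP
  set e := expectedPairCount alg (gaussianInstance w hw) t i j with he
  have he0 : 0 ≤ e := expectedPairCount_nonneg _ _ _ _ _
  set g : History I J t → ℝ := fun h => pairLogLikelihood i j (w i j) d h with hg
  have hgm : Measurable g := by fun_prop
  have hone : ∫⁻ h, ENNReal.ofReal (Real.exp (g h)) ∂P = 1 := by
    have := lintegral_historyLaw_change_pair alg hw hw' hij hne t (F := fun _ => 1) (by fun_prop)
    simpa using this.symm
  have hphi : ∀ z : ℝ, 0 ≤ Real.exp z - 1 - z := fun z => by linarith [Real.add_one_le_exp z]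
  rw [← ENNReal.ofReal_le_ofReal_iff (by positivity), ofReal_expectedPairCount,
    lintegral_historyLaw_change_pair alg hw hw' hij hne t (by fun_prop)]
  calc ∫⁻ h, ENNReal.ofReal (pairCount i j h) * ENNReal.ofReal (Real.exp (g h)) ∂P
      ≤ ∫⁻ h, (ENNReal.ofReal (pairCount i j h) +
          (ENNReal.ofReal (t * r) * ENNReal.ofReal (Real.exp (g h)) +
            ENNReal.ofReal (t / r) * ENNReal.ofReal (Real.exp (g h) - 1 - g h))) ∂P := by
        refine lintegral_mono fun h => ?_
        have hc0 := pairCount_nonneg i j h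
        have hct := pairCount_le i j h
        have hphi0 := hphi (g h)
        have hexp := (Real.exp_pos (g h)).le
        rw [← ENNReal.ofReal_mul hc0, ← ENNReal.ofReal_mul (by positivity),
          ← ENNReal.ofReal_mul (by positivity), ← ENNReal.ofReal_add (by positivity)
          (by positivity), ← ENNReal.ofReal_add hc0 (by positivity)]
        refine ENNReal.ofReal_le_ofReal ?_
        have h1 := mul_le_mul_of_nonneg_left (exp_le_of_pos (g h) hr) hc0
        have h2 : 0 ≤ r * Real.exp (g h) + (Real.exp (g h) - 1 - g h) / r := by positivity
        have h3 := mul_le_mul_of_nonneg_right hct h2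
        have h4 : (t : ℝ) / r * (Real.exp (g h) - 1 - g h) =
          t * ((Real.exp (g h) - 1 - g h) / r) := by ring
        rw [h4]
        linarith
    _ = ENNReal.ofReal (e + t * (r + d ^ 2 / 2 * e / r)) := by
        rw [lintegral_add_left (by fun_prop), lintegral_add_left (by fun_prop),
          lintegral_const_mul' _ _ ENNReal.ofReal_ne_top,
          lintegral_const_mul' _ _ ENNReal.ofReal_ne_top, hone,
          lintegral_exp_sub_one_sub_pairLogLikelihood, ← ofReal_expectedPairCount, ← he,
          mul_one, ← ENNReal.ofReal_mul (by positivity), ← ENNReal.ofReal_mul (by positivity),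
          ← ENNReal.ofReal_add (by positivity) (by positivity),
          ← ENNReal.ofReal_add (by positivity) (by positivity)]
        congr 1
        ring

end ChangeOfMeasure

/-! ### Regret and welfare -/

section Welfare

variable {I J : Type}

theorem sum_customers_eq_sum_matching [Fintype I] (X : Matching I J) {f : I → ℝ}
    (hf : ∀ i, (∀ j, (i, j) ∉ X.1) → f i = 0) : ∑ i, f i = ∑ p ∈ X.1, f p.1 := by
  classical
  rw [← Finset.sum_image (s := X.1) (g := Prod.fst) (f := f)]
  · refine (Finset.sum_subset (Finset.subset_univ _) fun i _ hi => hf i fun j hj => hi ?_).symm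
    exact Finset.mem_image_of_mem _ hj
  · intro p hp q hq hpq
    by_contra hne
    exact (X.2 p hp q hq hne).1 hpq

theorem sum_providers_eq_sum_matching [Fintype J] (X : Matching I J) {f : J → ℝ}
    (hf : ∀ j, (∀ i, (i, j) ∉ X.1) → f j = 0) : ∑ j, f j = ∑ p ∈ X.1, f p.2 := by
  classical
  rw [← Finset.sum_image (s := X.1) (g := Prod.snd) (f := f)]
  · refine (Finset.sum_subset (Finset.subset_univ _) fun i _ hi => hf i fun j hj => hi ?_).symm
    exact Finset.mem_image_of_mem _ hj
  · intro p hp q hq hpq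
    by_contra hne
    exact (X.2 p hp q hq hne).2 hpq

theorem partner_inl_of_unmatched {X : Matching I J} {i : I} (h : ∀ j, (i, j) ∉ X.1) :
    partner X (Sum.inl i) = Sum.inl i := by
  simp [partner, h]

theorem partner_inr_of_unmatched {X : Matching I J} {j : J} (h : ∀ i, (i, j) ∉ X.1) :
    partner X (Sum.inr j) = Sum.inr j := by
  simp [partner, h]

variable [Fintype I] [Fintype J]

theorem IsZeroSum.sum_eq_zero {X : Matching I J} {τ : I ⊕ J → ℝ} (h : IsZeroSum X τ) :
    ∑ a, τ a = 0 := by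
  rw [Fintype.sum_sum_type,
    sum_customers_eq_sum_matching X fun i hi => h.2 _ (partner_inl_of_unmatched hi),
    sum_providers_eq_sum_matching X fun j hj => h.2 _ (partner_inr_of_unmatched hj),
    ← Finset.sum_add_distrib]
  exact Finset.sum_eq_zero h.1

theorem sum_pairUtility_partner (w : I → J → ℝ) (X : Matching I J) :
    ∑ a, pairUtility w a (partner X a) = ∑ p ∈ X.1, w p.1 p.2 := by
  rw [Fintype.sum_sum_type]
  simp only [pairUtility_apply_inr, Finset.sum_const_zero, add_zero]
  rw [sum_customers_eq_sum_matching X fun i hi => by rw [partner_inl_of_unmatched hi]; rfl]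
  exact Finset.sum_congr rfl fun p hp => pairUtility_inl_partner_of_mem w hp

theorem welfare_sub_le_subsetInstability (w : I → J → ℝ) {X : Matching I J} {τ : I ⊕ J → ℝ}
    (h : IsZeroSum X τ) (X' : Matching I J) :
    ∑ p ∈ X'.1, w p.1 p.2 - ∑ p ∈ X.1, w p.1 p.2 ≤ subsetInstability (pairUtility w) X τ := by
  have : Finite (Matching I J) := Subtype.finite
  have h1 : ∑ p ∈ X'.1, w p.1 p.2 ≤ maxCoalitionUtility (pairUtility w) Finset.univ := by
    rw [← sum_pairUtility_partner]
    exact le_ciSup (f := fun Y : {Y : Matching I J // IsMatchingOn Finset.univ Y} =>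
      ∑ a, pairUtility w a (partner Y.1 a)) (Set.finite_range _).bddAbove
      ⟨X', fun p _ => by simp⟩
  have h2 := le_ciSup (f := fun S : Finset (I ⊕ J) => maxCoalitionUtility (pairUtility w) S -
    ∑ a ∈ S, (pairUtility w a (partner X a) + τ a)) (Set.finite_range _).bddAbove Finset.univ
  rw [Finset.sum_add_distrib, h.sum_eq_zero, sum_pairUtility_partner] at h2
  unfold subsetInstability
  linarith

theorem sum_matching_eq_sum_pairIndicator (w : I → J → ℝ) (X : Matching I J) :
    ∑ p ∈ X.1, w p.1 p.2 = ∑ i, ∑ j, w i j * pairIndicator i j X := by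
  classical
  rw [← Finset.sum_product' (s := Finset.univ) (t := Finset.univ)
    (f := fun i j => w i j * pairIndicator i j X)]
  simp [pairIndicator]

theorem welfare_sub_le_regret (w : I → J → ℝ) {T : ℕ} (h : History I J T) (X' : Matching I J) :
    T * ∑ p ∈ X'.1, w p.1 p.2 - ∑ i, ∑ j, w i j * pairCount i j h ≤
      regret (pairUtility w) h := by
  have h1 : ∑ i, ∑ j, w i j * pairCount i j h =
      ∑ t : Fin T, ∑ p ∈ (h t).1.1.1.1, w p.1 p.2 := by
    simp_rw [sum_matching_eq_sum_pairIndicator, pairCount, Finset.mul_sum]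
    rw [Finset.sum_comm]
    refine (Finset.sum_congr rfl fun j _ => Finset.sum_comm).trans ?_
    rw [Finset.sum_comm]
    exact Finset.sum_congr rfl fun t _ => Finset.sum_comm
  have h2 : T * ∑ p ∈ X'.1, w p.1 p.2 = ∑ _t : Fin T, ∑ p ∈ X'.1, w p.1 p.2 := by simp
  rw [h1, h2, ← Finset.sum_sub_distrib]
  exact Finset.sum_le_sum fun t _ => welfare_sub_le_subsetInstability w (h t).1.2 X'

theorem ofReal_welfare_sub_le_expectedRegret (alg : Algorithm I J) {w : I → J → ℝ}
    (hw : ∀ i j, w i j ∈ Set.Icc (-1 : ℝ) 1) (T : ℕ) (X' : Matching I J) :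
    ENNReal.ofReal (T * ∑ p ∈ X'.1, w p.1 p.2 -
        ∑ i, ∑ j, w i j * expectedPairCount alg (gaussianInstance w hw) T i j) ≤
      expectedRegret alg (gaussianInstance w hw) T := by
  set P := historyLaw alg (gaussianInstance w hw) T with hP
  set f : History I J T → ℝ := fun h =>
    T * ∑ p ∈ X'.1, w p.1 p.2 - ∑ i, ∑ j, w i j * pairCount i j h with hf
  have hint : ∀ i j, Integrable (fun h => w i j * pairCount i j h) P := fun i j =>
    (integrable_pairCount alg _ T i j).const_mul _
  have hsum : Integrable (fun h => ∑ i, ∑ j, w i j * pairCount i j h) P :=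
    integrable_finsetSum _ fun i _ => integrable_finsetSum _ fun j _ => hint i j
  have hfi : Integrable f P := (integrable_const _).sub hsum
  have heq : ∫ h, f h ∂P = T * ∑ p ∈ X'.1, w p.1 p.2 -
      ∑ i, ∑ j, w i j * expectedPairCount alg (gaussianInstance w hw) T i j := by
    rw [integral_sub (integrable_const _) hsum, integral_finsetSum _ fun i _ =>
      integrable_finsetSum _ fun j _ => hint i j]
    congr 1
    · simp
    · refine Finset.sum_congr rfl fun i _ => ?_
      rw [integral_finsetSum _ fun j _ => hint i j]
      exact Finset.sum_congr rfl fun j _ => integral_const_mul _ _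
  rw [← heq]
  -- The regret need not be integrable; only its integrable lower bound `f` is integrated as a real
  -- function.
  calc ENNReal.ofReal (∫ h, f h ∂P) ≤ ENNReal.ofReal (∫ h, max (f h) 0 ∂P) :=
        ENNReal.ofReal_le_ofReal
          (integral_mono hfi hfi.pos_part fun h => le_max_left _ _)
    _ = ∫⁻ h, ENNReal.ofReal (max (f h) 0) ∂P :=
        ofReal_integral_eq_lintegral_ofReal hfi.pos_part
          (Filter.Eventually.of_forall fun h => le_max_right _ _)
    _ ≤ ∫⁻ h, ENNReal.ofReal (regret (pairUtility w) h) ∂P := by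
        refine lintegral_mono fun h => ?_
        rw [ENNReal.ofReal_max, ENNReal.ofReal_zero, max_eq_left zero_le]
        exact ENNReal.ofReal_le_ofReal (welfare_sub_le_regret w h X')

end Welfare

/-! ### A hidden favourite provider for every customer -/

section Favourite

variable {I J : Type}

/-- Resampling one coordinate preserves the uniform law on maps: exchanging `σ i` with the fresh
value is an involution. -/
theorem card_mul_sum_eq_sum_update [Fintype I] [Fintype J] [DecidableEq I] (i : I) (G : (I → J) → ℝ) :
    (Fintype.card J : ℝ) * ∑ σ, G σ = ∑ σ : I → J, ∑ j, G (Function.update σ i j) := by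
  have hinv : Function.Involutive fun z : (I → J) × J => (Function.update z.1 i z.2, z.1 i) := by
    rintro ⟨σ, j⟩
    simp
  rw [← Fintype.sum_prod_type' (f := fun σ j => G (Function.update σ i j)),
    Fintype.sum_equiv hinv.toPerm (fun z => G (Function.update z.1 i z.2)) (fun z => G z.1)
      fun z => rfl, Fintype.sum_prod_type]
  simp [Finset.mul_sum]

variable [DecidableEq J]

/-- The value `none` provides the reference instance in which a customer has no favourite. -/
def favouriteUtility (Δ : ℝ) (θ : I → Option J) (i : I) (j : J) : ℝ :=
  if θ i = some j then Δ else 0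

theorem favouriteUtility_mem {Δ : ℝ} (h0 : 0 ≤ Δ) (h1 : Δ ≤ 1) (θ : I → Option J) (i : I)
    (j : J) : favouriteUtility Δ θ i j ∈ Set.Icc (-1 : ℝ) 1 := by
  unfold favouriteUtility
  split_ifs
  · exact ⟨by linarith, h1⟩
  · simp

variable [Fintype I]

/-- Match each provider in the image of `σ` with one customer who favours it. -/
theorem exists_matching_welfare_favouriteUtility (Δ : ℝ) (σ : I → J) :
    ∃ X : Matching I J, ∑ p ∈ X.1, favouriteUtility Δ (fun i => some (σ i)) p.1 p.2 =
      (Finset.univ.image σ).card * Δ := by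
  classical
  have hex : ∀ j : Finset.univ.image σ, ∃ i, σ i = j := fun j => by
    obtain ⟨i, -, hi⟩ := Finset.mem_image.1 j.2
    exact ⟨i, hi⟩
  choose f hf using hex
  have hinj : Function.Injective fun j : Finset.univ.image σ => (f j, (j : J)) := fun a b hab =>
    Subtype.ext (Prod.ext_iff.1 hab).2
  refine ⟨⟨Finset.univ.map ⟨_, hinj⟩, ?_⟩, ?_⟩
  · simp only [Finset.mem_map, Finset.mem_univ, true_and, Function.Embedding.coeFn_mk]
    rintro _ ⟨a, rfl⟩ _ ⟨b, rfl⟩ hne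
    have hab : (a : J) ≠ b := fun h => hne (by rw [Subtype.ext h])
    refine ⟨fun h => hab ?_, hab⟩
    rw [← hf a, ← hf b]
    exact congrArg σ h
  · simp only [Finset.sum_map, Function.Embedding.coeFn_mk, favouriteUtility, hf, if_true]
    simp

/-- For each provider, subtract the maps that avoid it. -/
theorem sum_card_image [Fintype J] [DecidableEq I] :
    ∑ σ : I → J, ((Finset.univ.image σ).card : ℝ) =
      Fintype.card J * ((Fintype.card J : ℝ) ^ Fintype.card I -
        ((Fintype.card J - 1 : ℕ) : ℝ) ^ Fintype.card I) := by
  have h1 : ∀ σ : I → J, ((Finset.univ.image σ).card : ℝ) =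
      ∑ j, (1 - if ∀ i, σ i ≠ j then (1 : ℝ) else 0) := fun σ => by
    rw [Finset.card_eq_sum_ones, Nat.cast_sum, ← Finset.sum_filter_add_sum_filter_not Finset.univ
      (fun j => j ∈ Finset.univ.image σ)]
    rw [Finset.sum_eq_zero (s := Finset.univ.filter fun j => ¬ j ∈ Finset.univ.image σ), add_zero]
    · refine Finset.sum_congr (by ext; simp) fun j hj => ?_
      obtain ⟨i, hi⟩ : ∃ i, σ i = j := by simpa using hj
      rw [if_neg fun h => h i hi]
      simp
    · intro j hj
      rw [if_pos (by simpa using hj)]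
      simp
  simp_rw [h1]
  rw [Finset.sum_comm]
  have h2 : ∀ j : J, ∑ σ : I → J, (1 - if ∀ i, σ i ≠ j then (1 : ℝ) else 0) =
      (Fintype.card J : ℝ) ^ Fintype.card I -
        ((Fintype.card J - 1 : ℕ) : ℝ) ^ Fintype.card I := fun j => by
    have h3 : (Finset.univ.filter fun σ : I → J => ∀ i, σ i ≠ j) =
        Fintype.piFinset fun _ => Finset.univ.erase j := by
      ext σ; simp
    rw [Finset.sum_sub_distrib, Finset.sum_boole, h3, Fintype.card_piFinset]
    simp
  simp only [h2, Finset.sum_const, Finset.card_univ, nsmul_eq_mul]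

/-- With `q = (1 - 1 / l) ^ k`, Bernoulli's inequality for `(1 + 1 / l) ^ k` gives `q ≤ l / (l +
k)`. Hence `l * (1 - q) ≥ l * k / (l + k)`, which is at least `2 / 3 * k` when `l ≥ 2 * k`. -/
theorem two_thirds_card_le_average_card_image [Fintype J] [DecidableEq I]
    (hI : 0 < Fintype.card I) (hIJ : 2 * Fintype.card I ≤ Fintype.card J) :
    (Fintype.card J : ℝ) ^ Fintype.card I * (2 / 3 * Fintype.card I) ≤
      ∑ σ : I → J, ((Finset.univ.image σ).card : ℝ) := by
  rw [sum_card_image]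
  generalize Fintype.card I = k at *
  generalize Fintype.card J = l at *
  have hl1 : 1 ≤ l := by omega
  have hl : (0 : ℝ) < l := by exact_mod_cast hl1
  have hlk : 2 * (k : ℝ) ≤ l := by exact_mod_cast hIJ
  have hk : (0 : ℝ) < k := by exact_mod_cast hI
  have hl' : 1 / (l : ℝ) ≤ 1 := by rw [div_le_one hl]; exact_mod_cast hl1
  set q : ℝ := (1 - 1 / l) ^ k with hq
  have hq0 : 0 ≤ q := pow_nonneg (by linarith) _
  have h1 : ((l - 1 : ℕ) : ℝ) ^ k = l ^ k * q := by
    rw [hq, ← mul_pow]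
    congr 1
    push_cast [hl1]
    field_simp
  have h2 : q * (1 + k / l) ≤ 1 := by
    have hb := one_add_mul_le_pow (a := 1 / (l : ℝ)) (by linarith [one_div_pos.2 hl]) k
    calc q * (1 + k / l) ≤ q * (1 + 1 / l) ^ k := by
          gcongr
          convert hb using 2
          ring
      _ = (1 - (1 / l) ^ 2) ^ k := by rw [hq, ← mul_pow]; ring
      _ ≤ 1 := pow_le_one₀ (by nlinarith [one_div_pos.2 hl]) (by nlinarith [one_div_pos.2 hl])
  have h3 : q * (l + k) ≤ l := by
    have := mul_le_mul_of_nonneg_right h2 hl.le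
    have h4 : q * (1 + k / l) * l = q * (l + k) := by field_simp
    linarith
  have h5 : 2 / 3 * (k : ℝ) ≤ l * (1 - q) := by nlinarith
  rw [h1]
  calc (l : ℝ) ^ k * (2 / 3 * k) ≤ l ^ k * (l * (1 - q)) := by gcongr
    _ = l * (l ^ k - l ^ k * q) := by ring

end Favourite

/-! ### Averaging over the hidden favourites -/

section Average

variable {I J : Type} [DecidableEq J] [Fintype I] [Fintype J]

theorem sum_expectedPairCount_favourite_le [DecidableEq I] (alg : Algorithm I J) {Δ : ℝ}
    (h0 : 0 ≤ Δ) (h1 : Δ ≤ 1) (T : ℕ) (i : I) {r : ℝ} (hr : 0 < r) :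
    Fintype.card J * ∑ σ : I → J, expectedPairCount alg
        (gaussianInstance _ (favouriteUtility_mem h0 h1 fun i => some (σ i))) T i (σ i) ≤
      (Fintype.card J : ℝ) ^ Fintype.card I *
        (T * (1 + Fintype.card J * r + T * (Δ ^ 2 / 2) / r)) := by
  rw [card_mul_sum_eq_sum_update i fun σ => expectedPairCount alg
        (gaussianInstance _ (favouriteUtility_mem h0 h1 fun i => some (σ i))) T i (σ i)]
  have hcard : (Fintype.card J : ℝ) ^ Fintype.card I *
      (T * (1 + Fintype.card J * r + T * (Δ ^ 2 / 2) / r)) =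
        ∑ _σ : I → J, (T * (1 + Fintype.card J * r + T * (Δ ^ 2 / 2) / r)) := by
    simp
  rw [hcard]
  refine Finset.sum_le_sum fun σ _ => ?_
  -- This reference does not depend on the candidate `j`, so its counts over all `j` share the
  -- budget `T`.
  set θ : I → Option J := Function.update (fun i => some (σ i)) i none with hθ
  set e : J → ℝ := expectedPairCount alg
    (gaussianInstance _ (favouriteUtility_mem h0 h1 θ)) T i with he
  have hsum : ∑ j, e j ≤ T := sum_expectedPairCount_le _ _ _ _
  have hle : ∀ j, expectedPairCount alg
      (gaussianInstance _ (favouriteUtility_mem h0 h1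
        fun i' => some (Function.update σ i j i'))) T i (Function.update σ i j i) ≤
      e j + T * (r + Δ ^ 2 / 2 * e j / r) := fun j => by
    rw [Function.update_self]
    refine expectedPairCount_change_pair_le alg (favouriteUtility_mem h0 h1 θ) _ ?_ ?_ T hr
    · simp [favouriteUtility, hθ]
    · intro i' j' hne
      by_cases hi : i' = i
      · subst hi
        have hj : ¬ j = j' := fun h => hne (by rw [h])
        simp [favouriteUtility, hθ, hj]
      · simp [favouriteUtility, hθ, hi]
  refine (Finset.sum_le_sum fun j _ => hle j).trans ?_
  have hrw : ∑ j, (e j + T * (r + Δ ^ 2 / 2 * e j / r)) =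
      (∑ j, e j) * (1 + T * (Δ ^ 2 / 2) / r) + T * (Fintype.card J * r) := by
    rw [Finset.sum_add_distrib, ← Finset.mul_sum, Finset.sum_add_distrib, ← Finset.sum_div,
      ← Finset.mul_sum]
    simp
    ring
  rw [hrw]
  have hpos : 0 ≤ 1 + T * (Δ ^ 2 / 2) / r := by positivity
  nlinarith [mul_le_mul_of_nonneg_right hsum hpos]

theorem exists_favourite_expectedRegret_ge (alg : Algorithm I J) (hI : 0 < Fintype.card I)
    (hIJ : 2 * Fintype.card I ≤ Fintype.card J) {T : ℕ} (hT : Fintype.card J ≤ T) :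
    ∃ inst : UnstructuredInstance I J,
      ENNReal.ofReal (Fintype.card I * √(Fintype.card J * T) / 216) ≤
        expectedRegret alg inst T := by
  classical
  set k := Fintype.card I with hk
  set l := Fintype.card J with hl
  have hk1 : (1 : ℝ) ≤ k := by exact_mod_cast hI
  have hl2 : (2 : ℝ) ≤ l := by exact_mod_cast (by omega : 2 ≤ l)
  have hlT : (l : ℝ) ≤ T := by exact_mod_cast hT
  have hTpos : (0 : ℝ) < T := by linarith
  have hlpos : (0 : ℝ) < l := by linarith
  -- Now `T * Δ ^ 2 = l / 324`, too little information to test all `l` candidates.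
  set Δ : ℝ := √(l / T) / 18 with hΔ
  have hsqrt : √((l : ℝ) / T) ≤ 1 := by
    rw [Real.sqrt_le_one, div_le_one hTpos]; exact hlT
  have h0 : 0 ≤ Δ := by positivity
  have h1 : Δ ≤ 1 := by rw [hΔ]; linarith
  have hΔ2 : T * Δ ^ 2 = l / 324 := by
    rw [hΔ, div_pow, Real.sq_sqrt (by positivity)]
    field_simp
    norm_num
  set e : (I → J) → I → ℝ := fun σ i => expectedPairCount alg
    (gaussianInstance _ (favouriteUtility_mem h0 h1 fun i => some (σ i))) T i (σ i) with he
  -- With `r = 1 / 18` the fraction is `1 / l + 1 / 18 + 1 / 36`, at most `7 / 12` because `l ≥ 2`.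
  have hbound : ∀ i, ∑ σ, e σ i ≤ (l : ℝ) ^ k * (T * (7 / 12)) := fun i => by
    have h2 := sum_expectedPairCount_favourite_le alg h0 h1 T i (r := 1 / 18) (by norm_num)
    have h3 : T * (Δ ^ 2 / 2) / (1 / 18) = l / 36 := by
      rw [show T * (Δ ^ 2 / 2) / (1 / 18) = 9 * (T * Δ ^ 2) by ring, hΔ2]; ring
    rw [h3] at h2
    have h4 : (l : ℝ) ^ k * (T * (1 + l * (1 / 18) + l / 36)) ≤
        l * ((l : ℝ) ^ k * (T * (7 / 12))) := by
      calc (l : ℝ) ^ k * (T * (1 + l * (1 / 18) + l / 36)) ≤ l ^ k * (T * (7 / 12 * l)) := by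
            gcongr; linarith
        _ = l * ((l : ℝ) ^ k * (T * (7 / 12))) := by ring
    exact le_of_mul_le_mul_left (h2.trans h4) hlpos
  -- Some `σ` does as well as the average, and `2 / 3 - 7 / 12 = 1 / 12`.
  obtain ⟨σ, -, hσ⟩ : ∃ σ ∈ (Finset.univ : Finset (I → J)),
      T * k / 12 ≤ T * ((Finset.univ.image σ).card : ℝ) - ∑ i, e σ i := by
    have hne : Nonempty J := Fintype.card_pos_iff.1 (by omega)
    refine Finset.exists_le_of_sum_le Finset.univ_nonempty ?_
    rw [Finset.sum_sub_distrib, ← Finset.mul_sum, Finset.sum_comm]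
    have h5 := mul_le_mul_of_nonneg_left (two_thirds_card_le_average_card_image hI hIJ) hTpos.le
    have h6 := Finset.sum_le_sum fun i (_ : i ∈ (Finset.univ : Finset I)) => hbound i
    simp only [Finset.sum_const, Finset.card_univ, Fintype.card_fun, nsmul_eq_mul, Nat.cast_pow,
      ← hk, ← hl] at h5 h6 ⊢
    linarith
  obtain ⟨X, hX⟩ := exists_matching_welfare_favouriteUtility Δ σ
  refine ⟨gaussianInstance _ (favouriteUtility_mem h0 h1 fun i => some (σ i)),
    le_trans (ENNReal.ofReal_le_ofReal ?_) (ofReal_welfare_sub_le_expectedRegret alg _ T X)⟩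
  have hS : ∑ i, ∑ j, favouriteUtility Δ (fun i => some (σ i)) i j * expectedPairCount alg
      (gaussianInstance _ (favouriteUtility_mem h0 h1 fun i => some (σ i))) T i j =
      Δ * ∑ i, e σ i := by
    rw [Finset.mul_sum]
    refine Finset.sum_congr rfl fun i _ => ?_
    simp [favouriteUtility, he]
  have hTΔ : T * Δ = √(l * T) / 18 := by
    rw [hΔ, show (l : ℝ) / T = l * T / T ^ 2 by field_simp, Real.sqrt_div (by positivity),
      Real.sqrt_sq hTpos.le]
    field_simp
  rw [hX, hS]
  calc (k : ℝ) * √(l * T) / 216 = Δ * (T * k / 12) := by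
        rw [show Δ * (T * k / 12) = T * Δ * k / 12 by ring, hTΔ]; ring
    _ ≤ Δ * (T * ((Finset.univ.image σ).card : ℝ) - ∑ i, e σ i) := by gcongr
    _ = _ := by ring

end Average

/-! ### A single customer with a single provider -/

/-- Two-point test between pair values `-Δ` and `Δ`: matching often loses under the first. Matching
rarely there forces at most `T / 2` expected matches under the second. -/
theorem exists_single_pair_expectedRegret_ge (alg : Algorithm (Fin 1) (Fin 1)) {T : ℕ}
    (hT : 1 ≤ T) :
    ∃ inst : UnstructuredInstance (Fin 1) (Fin 1),
      ENNReal.ofReal (√T / 32) ≤ expectedRegret alg inst T := by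
  have hT1 : (1 : ℝ) ≤ T := by exact_mod_cast hT
  set Δ : ℝ := 1 / (8 * √T) with hΔ
  have hs : 1 ≤ √(T : ℝ) := Real.one_le_sqrt.2 hT1
  have hss : √(T : ℝ) ^ 2 = T := Real.sq_sqrt (by linarith)
  have h0 : 0 ≤ Δ := by positivity
  have h1 : Δ ≤ 1 := by rw [hΔ, div_le_one (by positivity)]; linarith
  have hTΔ : T * Δ = √T / 8 := by
    rw [hΔ]; field_simp; linarith
  have hTΔ2 : T * Δ ^ 2 = 1 / 64 := by
    rw [hΔ, div_pow, mul_pow, hss]; field_simp; norm_num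
  have hwn : ∀ (_ _ : Fin 1), -Δ ∈ Set.Icc (-1 : ℝ) 1 := fun _ _ => ⟨by linarith, by linarith⟩
  have hwp : ∀ (_ _ : Fin 1), Δ ∈ Set.Icc (-1 : ℝ) 1 := fun _ _ => ⟨by linarith, by linarith⟩
  set en := expectedPairCount alg (gaussianInstance (fun _ _ => -Δ) hwn) T 0 0 with hen
  set ep := expectedPairCount alg (gaussianInstance (fun _ _ => Δ) hwp) T 0 0 with hep
  have hle : ep ≤ en + T * (1 / 8 + (2 * Δ) ^ 2 / 2 * en / (1 / 8)) :=
    expectedPairCount_change_pair_le alg hwn hwp (by ring)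
      (fun i j h => absurd (Subsingleton.elim (i, j) (0, 0)) h) T (by norm_num)
  have hle' : ep ≤ en * (5 / 4) + T / 8 := by
    have : T * (1 / 8 + (2 * Δ) ^ 2 / 2 * en / (1 / 8)) = T / 8 + 16 * (T * Δ ^ 2) * en := by ring
    rw [this, hTΔ2] at hle
    linarith
  by_cases hcase : T / 4 ≤ en
  · refine ⟨gaussianInstance (fun _ _ => -Δ) hwn, le_trans (ENNReal.ofReal_le_ofReal ?_)
      (ofReal_welfare_sub_le_expectedRegret alg hwn T ⟨∅, by simp⟩)⟩
    simp only [Finset.sum_empty, mul_zero, Finset.univ_unique, Fin.default_eq_zero, Fin.isValue,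
      Finset.sum_singleton, ← hen]
    nlinarith [mul_le_mul_of_nonneg_left hcase h0]
  · refine ⟨gaussianInstance (fun _ _ => Δ) hwp, le_trans (ENNReal.ofReal_le_ofReal ?_)
      (ofReal_welfare_sub_le_expectedRegret alg hwp T ⟨{(0, 0)}, by simp⟩)⟩
    simp only [Fin.isValue, Finset.sum_singleton, Finset.univ_unique, Fin.default_eq_zero, ← hep]
    have : ep ≤ T / 2 := by linarith
    nlinarith [mul_le_mul_of_nonneg_left this h0]

end MatchingBandit

end

/-! ### Choice of the market sizes and the constant -/

theorem lemma5p5 :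
    ∃ c : ℝ, 0 < c ∧ ∃ p : ℕ, ∀ n T : ℕ, 2 ≤ n → n ≤ T →
      ∃ k l : ℕ, k + l = n ∧
        ∀ alg : MatchingBandit.Algorithm (Fin k) (Fin l),
          ∃ inst : MatchingBandit.UnstructuredInstance (Fin k) (Fin l),
            ENNReal.ofReal
                (c * ((n : ℝ) ^ (3 / 2 : ℝ) * Real.sqrt (T : ℝ)) /
                  Real.log ((n : ℝ) * (T : ℝ)) ^ p) ≤
              MatchingBandit.expectedRegret alg inst T := by
  refine ⟨1 / 5000, by norm_num, 0, fun n T hn hnT => ?_⟩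
  simp only [pow_zero, div_one]
  have hpow : (n : ℝ) ^ (3 / 2 : ℝ) = n * √n := by
    rw [Real.sqrt_eq_rpow, ← Real.rpow_one_add' (by positivity) (by norm_num)]
    norm_num
  rw [hpow]
  -- For `n = 2` the split `n / 3` would leave no customers.
  rcases hn.eq_or_lt with rfl | hn3
  · refine ⟨1, 1, rfl, fun alg => ?_⟩
    obtain ⟨inst, h⟩ :=
      MatchingBandit.exists_single_pair_expectedRegret_ge alg (T := T) (by omega)
    refine ⟨inst, (ENNReal.ofReal_le_ofReal ?_).trans h⟩
    have h2 : √((2 : ℕ) : ℝ) ≤ 2 := by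
      rw [Real.sqrt_le_left (by norm_num)]; norm_num
    have h3 := mul_le_mul_of_nonneg_right h2 (Real.sqrt_nonneg (T : ℝ))
    push_cast at h3 ⊢
    nlinarith [Real.sqrt_nonneg (T : ℝ)]
  · refine ⟨n / 3, n - n / 3, by omega, fun alg => ?_⟩
    obtain ⟨inst, h⟩ := MatchingBandit.exists_favourite_expectedRegret_ge alg (T := T)
      (by simp; omega) (by simp; omega) (by simp; omega)
    refine ⟨inst, (ENNReal.ofReal_le_ofReal ?_).trans h⟩
    simp only [Fintype.card_fin]
    -- The factor `5` is attained at `n = 5`. With the factor `2` from `hsn` the loss is `10 * 216 =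
    -- 2160`, within `5000`.
    have hk : (n : ℝ) ≤ 5 * (n / 3 : ℕ) := by exact_mod_cast (by omega : n ≤ 5 * (n / 3))
    have hl : (n : ℝ) ≤ 4 * (n - n / 3 : ℕ) := by
      exact_mod_cast (by omega : n ≤ 4 * (n - n / 3))
    have hsn : √(n : ℝ) * √T ≤ 2 * √((n - n / 3 : ℕ) * T) := by
      rw [← Real.sqrt_mul (by positivity)]
      calc √((n : ℝ) * T) ≤ √(2 ^ 2 * ((n - n / 3 : ℕ) * T)) := by
            apply Real.sqrt_le_sqrt
            have := mul_le_mul_of_nonneg_right hl (Nat.cast_nonneg (α := ℝ) T)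
            linarith
        _ = 2 * √((n - n / 3 : ℕ) * T) := by
            rw [Real.sqrt_mul (by norm_num), Real.sqrt_sq (by norm_num)]
    have := mul_le_mul hk hsn (by positivity) (by positivity)
    have hnn : 0 ≤ ((n / 3 : ℕ) : ℝ) * √((n - n / 3 : ℕ) * T) := by positivity
    linarith
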